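/- Let $(\mathcal O,g)$ be a compact Riemannian orbifold with boundary, not necessarily connected. Its *Steklov spectrum* is the spectrum, with multiplicities, of the Dirichlet-to-Neumann operator $u\mapsto\partial_\nu(Hu)$ on $C^\infty(\partial\mathcal O)$, where $Hu$ is the harmonic extension of $u$ to $\mathcal O$ and $\partial_\nu$ is the outward normal derivative. A connected component of the orbifold boundary $\partial\mathcal O$ is called *singular* if it contains a singular point (a point with non-trivial isotropy), and *smooth* otherwise. **Proposition.** The Steklov spectrum does not determine the number of smooth versus singular boundary components in dimensions greater than two: for every $n>2$ there are two compact $n$-dimensional Riemannian orbifolds with boundary which have the same Steklov spectrum, but which have different numbers of smooth boundary components and different numbers of singular boundary components. In dimension three, examples are given as follows. Let $B\subset\mathbf R^3$ be the closed Euclidean unit ball, and let the Klein four-group $G=\{1,\sigma,\tau,\sigma\tau\}$ act on $B$ in one of the following two ways: (a) $\sigma,\tau$ are the rotations through the angle $\pi$ about the $x$-axis and the $y$-axis (so that $\sigma\tau$ is the rotation through $\pi$ about the $z$-axis); (b) $\sigma,\tau$ are the reflections across the $xy$-plane and the $xz$-plane (so that $\sigma\tau$ is the rotation through $\pi$ about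 the $x$-axis). In both cases the orbifolds $$\mathcal O_H=\{1,\sigma\}\backslash B\ \sqcup\ \{1,\tau\}\backslash B\ \sqcup\ \{1,\sigma\tau\}\backslash B,\qquad \mathcal O_K=B\ \sqcup\ G\backslash B\ \sqcup\ G\backslash B$$ have the same Steklov spectrum; $\mathcal O_H$ has no smooth and three singular boundary components, whereas $\mathcal O_K$ has one smooth and two singular boundary components. -/

import Mathlib

open Set Topology
open scoped ContDiff

namespace SteklovOrbifold

/-- Euclidean `n`-space. -/
abbrev E (n : ℕ) : Type := EuclideanSpace ℝ (Fin n)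

/-! ### Local models: regular domains in Euclidean space -/

/-- A connected regular domain in `ℝⁿ`: the set `{x ∈ V | 0 ≤ ρ x}`, where `V` is open and `0` is
a regular value of the smooth function `ρ` on `V`. It is an `n`-manifold with (possibly empty)
boundary `{x ∈ V | ρ x = 0}`. A connected relatively open subset of the half-space
`{x | 0 ≤ xₙ}` is the case `ρ x = xₙ`, and by the implicit function theorem every regular
domain is locally diffeomorphic to such a set. -/
structure RegularDomain (n : ℕ) where
  ambient : Set (E n)
  isOpen_ambient : IsOpen ambient
  defFun : E n → ℝ
  contDiffOn_defFun : ContDiffOn ℝ ∞ defFun ambient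
  regular : ∀ x ∈ ambient, defFun x = 0 → fderiv ℝ defFun x ≠ 0
  isConnected : IsConnected {x | x ∈ ambient ∧ 0 ≤ defFun x}

namespace RegularDomain

variable {n : ℕ} (D : RegularDomain n)

/-- The points of the domain (including its boundary points). -/
def dom : Set (E n) := {x | x ∈ D.ambient ∧ 0 ≤ D.defFun x}

/-- The manifold interior of the domain. -/
def inner : Set (E n) := {x | x ∈ D.ambient ∧ 0 < D.defFun x}

/-- The manifold boundary of the domain. -/
def bdry : Set (E n) := {x | x ∈ D.ambient ∧ D.defFun x = 0}

lemma inner_subset_dom : D.inner ⊆ D.dom := fun _ hx => ⟨hx.1, hx.2.le⟩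

lemma bdry_subset_dom : D.bdry ⊆ D.dom := fun _ hx => ⟨hx.1, hx.2.ge⟩

lemma isOpen_inner : IsOpen D.inner :=
  D.contDiffOn_defFun.continuousOn.isOpen_inter_preimage D.isOpen_ambient isOpen_Ioi

lemma dom_mem_nhds {x : E n} (hx : x ∈ D.inner) : D.dom ∈ 𝓝 x :=
  Filter.mem_of_superset (D.isOpen_inner.mem_nhds hx) D.inner_subset_dom

/-- Derivatives within a regular domain are unique, also at boundary points. -/
lemma uniqueDiffOn : UniqueDiffOn ℝ D.dom := by
  intro x hx
  rcases hx.2.lt_or_eq with h | h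
  · exact uniqueDiffWithinAt_of_mem_nhds (D.dom_mem_nhds ⟨hx.1, h⟩)
  have hV := D.isOpen_ambient.mem_nhds hx.1
  have hd : HasFDerivAt D.defFun (fderiv ℝ D.defFun x) x :=
    ((D.contDiffOn_defFun.contDiffAt hV).differentiableAt (by simp)).hasFDerivAt
  set L := fderiv ℝ D.defFun x with hL
  have hL0 : L ≠ 0 := D.regular x hx.1 h.symm
  have key : ∀ v : E n, 0 < L v → v ∈ tangentConeAt ℝ D.dom x := by
    intro v hv
    have hline : HasDerivAt (fun t : ℝ => x + t • v) v 0 := by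
      simpa using ((hasDerivAt_id (0 : ℝ)).smul_const v).const_add x
    have hcomp : HasDerivAt (fun t : ℝ => D.defFun (x + t • v)) (L v) 0 := by
      have hd' : HasFDerivAt D.defFun L (x + (0 : ℝ) • v) := by simpa using hd
      exact hd'.comp_hasDerivAt (0 : ℝ) hline
    have hpos : ∀ᶠ t in 𝓝[>] (0 : ℝ), 0 < D.defFun (x + t • v) := by
      have h1 := hcomp.tendsto_slope_zero_right
      have h2 := h1.eventually (lt_mem_nhds hv)
      filter_upwards [h2, self_mem_nhdsWithin] with t ht ht0
      have ht0' : 0 < t := ht0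
      simp only [zero_add, zero_smul, add_zero, ← h, sub_zero, smul_eq_mul] at ht
      have := mul_pos ht0' ht
      rwa [mul_inv_cancel_left₀ ht0'.ne'] at this
    have hin : ∀ᶠ t in 𝓝[>] (0 : ℝ), x + t • v ∈ D.ambient := by
      have : Filter.Tendsto (fun t : ℝ => x + t • v) (𝓝 0) (𝓝 x) := by
        simpa using hline.continuousAt.tendsto
      exact (this.eventually hV).filter_mono nhdsWithin_le_nhds
    have hmem : ∀ᶠ t in 𝓝[>] (0 : ℝ), x + t • v ∈ D.dom := by
      filter_upwards [hpos, hin] with t h1 h2 using ⟨h2, h1.le⟩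
    refine mem_tangentConeAt_of_frequently (𝓝[>] (0 : ℝ)) (fun t => t⁻¹) (fun t => t • v)
      ?_ hmem.frequently ?_
    · have : Filter.Tendsto (fun t : ℝ => t • v) (𝓝 0) (𝓝 ((0 : ℝ) • v)) :=
        (continuous_id.smul continuous_const).tendsto 0
      rw [zero_smul] at this
      exact this.mono_left nhdsWithin_le_nhds
    · refine tendsto_const_nhds.congr' ?_
      filter_upwards [self_mem_nhdsWithin] with t ht
      have ht' : t ≠ 0 := ne_of_gt ht
      simp [smul_smul, ht']
  obtain ⟨w, hw⟩ : ∃ w, 0 < L w := by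
    by_contra! hcon
    apply hL0
    ext w
    have h1 := hcon w
    have h2 := hcon (-w)
    rw [map_neg] at h2
    simpa using le_antisymm h1 (by linarith)
  refine ⟨?_, subset_closure hx⟩
  have : Submodule.span ℝ (tangentConeAt ℝ D.dom x) = ⊤ := by
    rw [eq_top_iff]
    rintro v -
    obtain ⟨c, hc⟩ : ∃ c : ℝ, 0 < L (v + c • w) := by
      refine ⟨(1 - L v) / L w, ?_⟩
      rw [map_add, map_smul, smul_eq_mul, div_mul_cancel₀ _ hw.ne']
      linarith
    have h1 := Submodule.subset_span (R := ℝ) (key _ hc)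
    have h2 := Submodule.subset_span (R := ℝ) (key _ hw)
    have := Submodule.sub_mem _ h1 (Submodule.smul_mem _ c h2)
    simpa using this
  rw [this]
  simp

end RegularDomain

/-! ### Riemannian geometry in a regular domain -/

/-- The bilinear form with matrix `G`. -/
def metricForm {n : ℕ} (G : Matrix (Fin n) (Fin n) ℝ) (v w : E n) : ℝ :=
  ∑ a, ∑ b, v a * G a b * w b

/-- The `a`-th standard basis vector. -/
noncomputable def stdVec {n : ℕ} (a : Fin n) : E n := EuclideanSpace.single a 1

/-- The Laplace-Beltrami operator of the metric `g` at an interior point, in coordinates: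
`(det g)^(-1/2) ∑ₐ ∂ₐ ((det g)^(1/2) ∑_b g^{ab} ∂_b f)` with the product rule carried out, i.e.
`∑_{a,b} g^{ab} ∂ₐ∂_b f + ∑_{a,b} (det g)^(-1/2) ∂ₐ((det g)^(1/2) g^{ab}) ∂_b f`. -/
noncomputable def laplaceBeltrami {n : ℕ} (g : E n → Matrix (Fin n) (Fin n) ℝ) (f : E n → ℝ)
    (x : E n) : ℝ :=
  (∑ a, ∑ b, (g x)⁻¹ a b * fderiv ℝ (fun y => fderiv ℝ f y (stdVec b)) x (stdVec a)) +
  ∑ a, ∑ b, fderiv ℝ (fun y => √(g y).det * (g y)⁻¹ a b) x (stdVec a) / √(g x).det *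
    fderiv ℝ f x (stdVec b)

/-- The derivative, at a boundary point `x` of `D`, of `f` in the direction of the outward unit
normal `-(grad ρ) / |grad ρ|` with respect to the metric `g`. -/
noncomputable def RegularDomain.normalDeriv {n : ℕ} (D : RegularDomain n)
    (g : E n → Matrix (Fin n) (Fin n) ℝ) (f : E n → ℝ) (x : E n) : ℝ :=
  -(∑ a, ∑ b, fderiv ℝ D.defFun x (stdVec a) * (g x)⁻¹ a b *
      fderivWithin ℝ f D.dom x (stdVec b)) /
    √(∑ a, ∑ b, fderiv ℝ D.defFun x (stdVec a) * (g x)⁻¹ a b * fderiv ℝ D.defFun x (stdVec b))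

/-! ### Riemannian orbifolds with boundary -/

/-- A Riemannian orbifold chart (possibly with boundary) on a topological space `X`: a connected
regular domain with an effective smooth action of a finite group and an invariant Riemannian
metric, together with a map `proj` which induces a homeomorphism from the orbit space onto an open
subset of `X`. Only the values of `act`, `proj`, `metric` on the domain matter. -/
structure OrbifoldChart (n : ℕ) (X : Type) [TopologicalSpace X] extends RegularDomain n where
  Grp : Type
  [instGroup : Group Grp]
  [instFinite : Finite Grp]
  act : Grp → E n → E n
  act_mem : ∀ γ, MapsTo (act γ) toRegularDomain.dom toRegularDomain.dom
  act_one : ∀ x ∈ toRegularDomain.dom, act 1 x = x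
  act_mul : ∀ γ δ, ∀ x ∈ toRegularDomain.dom, act (γ * δ) x = act γ (act δ x)
  act_smooth : ∀ γ, ContDiffOn ℝ ∞ (act γ) toRegularDomain.dom
  act_effective : ∀ γ, (∀ x ∈ toRegularDomain.dom, act γ x = x) → γ = 1
  proj : E n → X
  proj_continuousOn : ContinuousOn proj toRegularDomain.dom
  proj_eq_iff : ∀ x ∈ toRegularDomain.dom, ∀ y ∈ toRegularDomain.dom,
    (proj x = proj y ↔ ∃ γ, act γ x = y)
  proj_isOpen : ∀ W : Set (E n), IsOpen W → IsOpen (proj '' (W ∩ toRegularDomain.dom))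
  metric : E n → Matrix (Fin n) (Fin n) ℝ
  metric_smooth : ∀ a b, ContDiffOn ℝ ∞ (fun x => metric x a b) toRegularDomain.dom
  metric_posDef : ∀ x ∈ toRegularDomain.dom, (metric x).PosDef
  metric_invariant : ∀ γ, ∀ x ∈ toRegularDomain.dom, ∀ v w : E n,
    metricForm (metric (act γ x)) (fderivWithin ℝ (act γ) toRegularDomain.dom x v)
      (fderivWithin ℝ (act γ) toRegularDomain.dom x w) = metricForm (metric x) v w

attribute [instance] OrbifoldChart.instGroup OrbifoldChart.instFinite

/-- Compatibility of two Riemannian orbifold charts: whenever `x` and `y` lie over the same point,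
there is an isometric diffeomorphism `ψ` from a neighbourhood of `x` onto a neighbourhood of `y`
which maps `x` to `y` and commutes with the projections. -/
def OrbifoldChart.Compatible {n : ℕ} {X : Type} [TopologicalSpace X]
    (c d : OrbifoldChart n X) : Prop :=
  ∀ x ∈ c.dom, ∀ y ∈ d.dom, c.proj x = d.proj y →
    ∃ (W W' : Set (E n)) (ψ ψ' : E n → E n),
      IsOpen W ∧ x ∈ W ∧ IsOpen W' ∧ y ∈ W' ∧ ψ x = y ∧
      MapsTo ψ (W ∩ c.dom) (W' ∩ d.dom) ∧ MapsTo ψ' (W' ∩ d.dom) (W ∩ c.dom) ∧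
      InvOn ψ' ψ (W ∩ c.dom) (W' ∩ d.dom) ∧
      ContDiffOn ℝ ∞ ψ (W ∩ c.dom) ∧ ContDiffOn ℝ ∞ ψ' (W' ∩ d.dom) ∧
      (∀ z ∈ W ∩ c.dom, d.proj (ψ z) = c.proj z) ∧
      ∀ z ∈ W ∩ c.dom, ∀ v w : E n,
        metricForm (d.metric (ψ z)) (fderivWithin ℝ ψ c.dom z v) (fderivWithin ℝ ψ c.dom z w) =
          metricForm (c.metric z) v w

/-- A compact `n`-dimensional Riemannian orbifold with (possibly empty) boundary, not necessarily
connected. -/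
structure CompactRiemannianOrbifold (n : ℕ) where
  carrier : Type
  [instTop : TopologicalSpace carrier]
  [instT2 : T2Space carrier]
  [instSecondCountable : SecondCountableTopology carrier]
  [instCompact : CompactSpace carrier]
  ChartIndex : Type
  chart : ChartIndex → OrbifoldChart n carrier
  cover : ∀ p : carrier, ∃ i, ∃ x ∈ (chart i).dom, (chart i).proj x = p
  compatible : ∀ i j, (chart i).Compatible (chart j)

attribute [instance] CompactRiemannianOrbifold.instTop CompactRiemannianOrbifold.instT2
  CompactRiemannianOrbifold.instSecondCountable CompactRiemannianOrbifold.instCompact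

namespace CompactRiemannianOrbifold

variable {n : ℕ} (O : CompactRiemannianOrbifold n)

/-- The orbifold boundary, with the subspace topology. -/
def boundary : Set O.carrier :=
  {p | ∃ i, ∃ x ∈ (O.chart i).bdry, (O.chart i).proj x = p}

/-- A point is singular if some lift of it to some chart has non-trivial isotropy group. -/
def IsSingular (p : O.carrier) : Prop :=
  ∃ i, ∃ x ∈ (O.chart i).dom, (O.chart i).proj x = p ∧ ∃ γ, γ ≠ 1 ∧ (O.chart i).act γ x = x

/-- The number of boundary components all of whose points are regular. -/
noncomputable def numSmoothBoundaryComponents : ℕ∞ :=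
  ENat.card {c : ConnectedComponents O.boundary //
    ∀ p : O.boundary, ConnectedComponents.mk p = c → ¬ O.IsSingular p}

/-- The number of boundary components which contain a singular point. -/
noncomputable def numSingularBoundaryComponents : ℕ∞ :=
  ENat.card {c : ConnectedComponents O.boundary //
    ∃ p : O.boundary, ConnectedComponents.mk p = c ∧ O.IsSingular p}

/-- The lift of a function on the orbifold to a chart. -/
def lift (i : O.ChartIndex) (f : O.carrier → ℝ) : E n → ℝ := f ∘ (O.chart i).proj

/-- Smooth functions on the orbifold (smooth up to the boundary): all lifts are smooth. -/
def IsSmooth (f : O.carrier → ℝ) : Prop :=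
  ∀ i, ContDiffOn ℝ ∞ (O.lift i f) (O.chart i).dom

/-- Harmonic functions on the orbifold. -/
def IsHarmonic (f : O.carrier → ℝ) : Prop :=
  ∀ i, ∀ x ∈ (O.chart i).inner, laplaceBeltrami (O.chart i).metric (O.lift i f) x = 0

/-- `v` is the outward normal derivative `∂_ν f` of `f` along the orbifold boundary: at all lifts
of boundary points to charts, `v` is the outward normal derivative of the lift of `f`. -/
def IsNormalDeriv (f : O.carrier → ℝ) (v : O.boundary → ℝ) : Prop :=
  ∀ i, ∀ x, ∀ hx : x ∈ (O.chart i).bdry,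
    (O.chart i).normalDeriv (O.chart i).metric (O.lift i f) x =
      v ⟨(O.chart i).proj x, i, x, hx, rfl⟩

section Linearity

variable {O}

lemma lift_add (i : O.ChartIndex) (f h : O.carrier → ℝ) :
    O.lift i (f + h) = O.lift i f + O.lift i h := rfl

lemma lift_smul (i : O.ChartIndex) (c : ℝ) (f : O.carrier → ℝ) :
    O.lift i (c • f) = c • O.lift i f := rfl

lemma IsSmooth.add {f h : O.carrier → ℝ} (hf : O.IsSmooth f) (hh : O.IsSmooth h) :
    O.IsSmooth (f + h) := fun i => by
  rw [lift_add]
  exact (hf i).add (hh i)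

lemma IsSmooth.smul (c : ℝ) {f : O.carrier → ℝ} (hf : O.IsSmooth f) :
    O.IsSmooth (c • f) := fun i => by
  rw [lift_smul]
  exact contDiffOn_const.smul (hf i)

lemma IsSmooth.contDiffAt {f : O.carrier → ℝ} (hf : O.IsSmooth f) (i : O.ChartIndex) {x : E n}
    (hx : x ∈ (O.chart i).inner) : ContDiffAt ℝ ∞ (O.lift i f) x :=
  (hf i).contDiffAt ((O.chart i).dom_mem_nhds hx)

end Linearity

end CompactRiemannianOrbifold

lemma differentiableAt_partial {n : ℕ} {f : E n → ℝ} {x : E n} (hf : ContDiffAt ℝ ∞ f x)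
    (v : E n) : DifferentiableAt ℝ (fun y => fderiv ℝ f y v) x := by
  have h1 : ContDiffAt ℝ 1 (fderiv ℝ f) x :=
    (contDiffAt_infty.1 hf 2).fderiv_right (m := 1) (by norm_num)
  exact (h1.differentiableAt (by simp)).clm_apply (differentiableAt_const v)

lemma laplaceBeltrami_add {n : ℕ} (g : E n → Matrix (Fin n) (Fin n) ℝ) {f h : E n → ℝ} {x : E n}
    (hf : ContDiffAt ℝ ∞ f x) (hh : ContDiffAt ℝ ∞ h x) :
    laplaceBeltrami g (f + h) x = laplaceBeltrami g f x + laplaceBeltrami g h x := by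
  have e1 : ∀ᶠ y in 𝓝 x, DifferentiableAt ℝ f y ∧ DifferentiableAt ℝ h y := by
    have hf1 : ContDiffAt ℝ 1 f x := hf.of_le (by exact_mod_cast le_top)
    have hh1 : ContDiffAt ℝ 1 h x := hh.of_le (by exact_mod_cast le_top)
    filter_upwards [hf1.eventually (by simp), hh1.eventually (by simp)] with y h1 h2
    exact ⟨h1.differentiableAt (by simp), h2.differentiableAt (by simp)⟩
  have e2 : ∀ y, DifferentiableAt ℝ f y ∧ DifferentiableAt ℝ h y → ∀ v,
      fderiv ℝ (f + h) y v = fderiv ℝ f y v + fderiv ℝ h y v := by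
    intro y hy v
    rw [fderiv_add hy.1 hy.2]
    rfl
  have e3 : ∀ v w, fderiv ℝ (fun y => fderiv ℝ (f + h) y v) x w =
      fderiv ℝ (fun y => fderiv ℝ f y v) x w + fderiv ℝ (fun y => fderiv ℝ h y v) x w := by
    intro v w
    have : (fun y => fderiv ℝ (f + h) y v) =ᶠ[𝓝 x]
        fun y => fderiv ℝ f y v + fderiv ℝ h y v := by
      filter_upwards [e1] with y hy using e2 y hy v
    rw [this.fderiv_eq, fderiv_fun_add (differentiableAt_partial hf v)
      (differentiableAt_partial hh v)]
    rfl
  simp only [laplaceBeltrami, e3, e2 x e1.self_of_nhds, mul_add, Finset.sum_add_distrib]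
  ring

lemma laplaceBeltrami_smul {n : ℕ} (g : E n → Matrix (Fin n) (Fin n) ℝ) (c : ℝ) (f : E n → ℝ)
    (x : E n) : laplaceBeltrami g (c • f) x = c * laplaceBeltrami g f x := by
  have e2 : ∀ y v, fderiv ℝ (c • f) y v = c * fderiv ℝ f y v := by
    intro y v
    rw [fderiv_const_smul_field]
    rfl
  have e3 : ∀ v w, fderiv ℝ (fun y => fderiv ℝ (c • f) y v) x w =
      c * fderiv ℝ (fun y => fderiv ℝ f y v) x w := by
    intro v w
    have : (fun y => fderiv ℝ (c • f) y v) = c • fun y => fderiv ℝ f y v := by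
      funext y
      exact e2 y v
    rw [this, fderiv_const_smul_field]
    rfl
  simp only [laplaceBeltrami, e3]
  simp only [e2, Finset.mul_sum, mul_add]
  congr 1 <;> refine Finset.sum_congr rfl fun a _ => Finset.sum_congr rfl fun b _ => ?_ <;> ring

lemma RegularDomain.normalDeriv_add {n : ℕ} (D : RegularDomain n)
    (g : E n → Matrix (Fin n) (Fin n) ℝ) {f h : E n → ℝ} {x : E n} (hx : x ∈ D.dom)
    (hf : ContDiffOn ℝ ∞ f D.dom) (hh : ContDiffOn ℝ ∞ h D.dom) :
    D.normalDeriv g (f + h) x = D.normalDeriv g f x + D.normalDeriv g h x := by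
  have e : fderivWithin ℝ (f + h) D.dom x = fderivWithin ℝ f D.dom x + fderivWithin ℝ h D.dom x :=
    fderivWithin_add (D.uniqueDiffOn x hx) (hf.differentiableOn (by simp) x hx)
      (hh.differentiableOn (by simp) x hx)
  simp only [RegularDomain.normalDeriv, e, add_apply, mul_add, Finset.sum_add_distrib]
  ring

lemma RegularDomain.normalDeriv_smul {n : ℕ} (D : RegularDomain n)
    (g : E n → Matrix (Fin n) (Fin n) ℝ) (c : ℝ) {f : E n → ℝ} {x : E n} (hx : x ∈ D.dom)
    (hf : ContDiffOn ℝ ∞ f D.dom) :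
    D.normalDeriv g (c • f) x = c * D.normalDeriv g f x := by
  have e : fderivWithin ℝ (c • f) D.dom x = c • fderivWithin ℝ f D.dom x :=
    fderivWithin_const_smul (D.uniqueDiffOn x hx) (hf.differentiableOn (by simp) x hx) c
  have e2 : ∀ a b, fderiv ℝ D.defFun x (stdVec a) * (g x)⁻¹ a b *
      (c • fderivWithin ℝ f D.dom x) (stdVec b) = c * (fderiv ℝ D.defFun x (stdVec a) *
        (g x)⁻¹ a b * fderivWithin ℝ f D.dom x (stdVec b)) := by
    intro a b
    rw [smul_apply, smul_eq_mul]
    ring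
  simp only [RegularDomain.normalDeriv, e, e2, ← Finset.mul_sum]
  ring

namespace CompactRiemannianOrbifold

variable {n : ℕ} (O : CompactRiemannianOrbifold n)

/-- The Dirichlet-to-Neumann operator `u ↦ ∂_ν (Hu)` on smooth functions on the orbifold boundary,
given by its graph: the pairs `(u, v)` for which there is a smooth harmonic function `Hu` on the
orbifold with boundary values `u` and outward normal derivative `v`. -/
def dirichletToNeumann : Submodule ℝ ((O.boundary → ℝ) × (O.boundary → ℝ)) where
  carrier := {uv | ∃ Hu : O.carrier → ℝ, O.IsSmooth Hu ∧ O.IsHarmonic Hu ∧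
    (∀ p : O.boundary, Hu p = uv.1 p) ∧ O.IsNormalDeriv Hu uv.2}
  zero_mem' := by
    refine ⟨0, fun i => contDiffOn_const, fun i x _ => ?_, fun p => rfl, fun i x hx => ?_⟩
    · have := laplaceBeltrami_smul (O.chart i).metric 0 (O.lift i 0) x
      rw [zero_smul, zero_mul] at this
      exact this
    · have := (O.chart i).normalDeriv_smul (O.chart i).metric 0 (f := O.lift i 0)
        ((O.chart i).bdry_subset_dom hx) contDiffOn_const
      rw [zero_smul, zero_mul] at this
      exact this
  add_mem' := by
    rintro a b ⟨f, hf1, hf2, hf3, hf4⟩ ⟨h, hh1, hh2, hh3, hh4⟩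
    refine ⟨f + h, hf1.add hh1, fun i x hx => ?_, fun p => ?_, fun i x hx => ?_⟩
    · rw [lift_add, laplaceBeltrami_add _ (hf1.contDiffAt i hx) (hh1.contDiffAt i hx), hf2 i x hx,
        hh2 i x hx, add_zero]
    · simp [hf3 p, hh3 p]
    · rw [lift_add, (O.chart i).normalDeriv_add _ ((O.chart i).bdry_subset_dom hx) (hf1 i) (hh1 i),
        hf4 i x hx, hh4 i x hx]
      rfl
  smul_mem' := by
    rintro c a ⟨f, hf1, hf2, hf3, hf4⟩
    refine ⟨c • f, hf1.smul c, fun i x hx => ?_, fun p => ?_, fun i x hx => ?_⟩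
    · rw [lift_smul, laplaceBeltrami_smul, hf2 i x hx, mul_zero]
    · simp [hf3 p]
    · rw [lift_smul, (O.chart i).normalDeriv_smul _ c ((O.chart i).bdry_subset_dom hx) (hf1 i),
        hf4 i x hx]
      rfl

/-- The eigenspace `{u | D u = σ u}` of the Dirichlet-to-Neumann operator `D`. -/
def steklovEigenspace (σ : ℝ) : Submodule ℝ (O.boundary → ℝ) :=
  O.dirichletToNeumann.comap (LinearMap.id.prod (σ • LinearMap.id))

/-- The Steklov spectrum, i.e. the eigenvalue spectrum of the Dirichlet-to-Neumann operator with
multiplicities, given by the function that maps `σ` to its multiplicity as a Steklov eigenvalue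
(which is zero if `σ` is not an eigenvalue). -/
noncomputable def steklovSpectrum (σ : ℝ) : Cardinal :=
  Module.rank ℝ (O.steklovEigenspace σ)

end CompactRiemannianOrbifold

/-! ### Disjoint unions of quotients of the Euclidean unit ball -/

/-- The closed unit ball in `ℝⁿ`. -/
abbrev UnitBall (n : ℕ) : Type := Metric.closedBall (0 : E n) 1

noncomputable instance (n : ℕ) : MulAction (E n ≃ₗᵢ[ℝ] E n) (UnitBall n) where
  smul g x := ⟨g x, by simpa [-Subtype.coe_prop] using mem_closedBall_zero_iff.1 x.2⟩
  one_smul _ := rfl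
  mul_smul _ _ _ := rfl

lemma coe_smul_unitBall {n : ℕ} (g : E n ≃ₗᵢ[ℝ] E n) (x : UnitBall n) :
    ((g • x : UnitBall n) : E n) = g x := rfl

instance (n : ℕ) (Γ : Subgroup (E n ≃ₗᵢ[ℝ] E n)) : ContinuousConstSMul Γ (UnitBall n) where
  continuous_const_smul g :=
    (g.1.continuous.comp continuous_subtype_val).subtype_mk fun x => (g.1 • x).2

/-- The closed unit ball as a regular domain. -/
noncomputable def ballDomain (n : ℕ) : RegularDomain n where
  ambient := univ
  isOpen_ambient := isOpen_univ
  defFun x := 1 - ‖x‖ ^ 2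
  contDiffOn_defFun := (contDiff_const.sub (contDiff_norm_sq ℝ)).contDiffOn
  regular := by
    intro x _ hx h
    have h2 : HasFDerivAt (fun y : E n => 1 - ‖y‖ ^ 2) (-(2 • innerSL ℝ x)) x :=
      (hasStrictFDerivAt_norm_sq x).hasFDerivAt.const_sub 1
    rw [h2.fderiv] at h
    have h3 := congrArg (fun L : E n →L[ℝ] ℝ => L x) h
    simp at h3
    simp [h3] at hx
  isConnected := by
    have : {x : E n | x ∈ (univ : Set (E n)) ∧ 0 ≤ 1 - ‖x‖ ^ 2} = Metric.closedBall 0 1 := by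
      ext x
      simp
    rw [this]
    exact ⟨⟨0, by simp⟩, (convex_closedBall 0 1).isPreconnected⟩

lemma ballDomain_dom (n : ℕ) : (ballDomain n).dom = Metric.closedBall 0 1 := by
  ext x
  simp [RegularDomain.dom, ballDomain]

/-- The underlying space of the disjoint union of the quotients `Γᵢ \ B(0,1)`. -/
abbrev BallQuotientSpace {n : ℕ} {ι : Type} (Γ : ι → Subgroup (E n ≃ₗᵢ[ℝ] E n)) : Type :=
  Σ i, MulAction.orbitRel.Quotient (Γ i) (UnitBall n)

open Classical in
/-- The quotient map from the unit ball onto the `i`-th component, extended by a junk value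
outside of the unit ball. -/
noncomputable def ballProj {n : ℕ} {ι : Type} (Γ : ι → Subgroup (E n ≃ₗᵢ[ℝ] E n)) (i : ι)
    (x : E n) : BallQuotientSpace Γ :=
  ⟨i, Quotient.mk _ (if hx : x ∈ Metric.closedBall (0 : E n) 1 then ⟨x, hx⟩ else ⟨0, by simp⟩)⟩

lemma ballProj_of_mem {n : ℕ} {ι : Type} (Γ : ι → Subgroup (E n ≃ₗᵢ[ℝ] E n)) (i : ι) {x : E n}
    (hx : x ∈ Metric.closedBall (0 : E n) 1) :
    ballProj Γ i x = ⟨i, Quotient.mk _ ⟨x, hx⟩⟩ := by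
  simp only [ballProj, dif_pos hx]

lemma ballProj_eq_iff {n : ℕ} {ι : Type} (Γ : ι → Subgroup (E n ≃ₗᵢ[ℝ] E n)) (i : ι) {x y : E n}
    (hx : x ∈ Metric.closedBall (0 : E n) 1) (hy : y ∈ Metric.closedBall (0 : E n) 1) :
    ballProj Γ i x = ballProj Γ i y ↔ ∃ γ : Γ i, γ.1 x = y := by
  rw [ballProj_of_mem Γ i hx, ballProj_of_mem Γ i hy, Sigma.mk.injEq, eq_self_iff_true, true_and,
    heq_iff_eq, eq_comm, Quotient.eq]
  constructor
  · rintro ⟨γ, hγ⟩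
    exact ⟨γ, congrArg Subtype.val hγ⟩
  · rintro ⟨γ, hγ⟩
    exact ⟨γ, Subtype.ext hγ⟩

lemma metricForm_isometry {n : ℕ} (g : E n ≃ₗᵢ[ℝ] E n) (v w : E n) :
    metricForm 1 (g v) (g w) = metricForm 1 v w := by
  have key : ∀ v w : E n, metricForm 1 v w = inner ℝ w v := by
    intro v w
    simp [metricForm, Matrix.one_apply, PiLp.inner_apply]
  rw [key, key, g.inner_map_map]

lemma fderivWithin_isometry {n : ℕ} (g : E n ≃ₗᵢ[ℝ] E n) {x : E n} (hx : x ∈ (ballDomain n).dom)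
    (v : E n) : fderivWithin ℝ g (ballDomain n).dom x v = g v := by
  have h := (g.toContinuousLinearEquiv.toContinuousLinearMap.hasFDerivWithinAt
    (s := (ballDomain n).dom) (x := x)).fderivWithin ((ballDomain n).uniqueDiffOn x hx)
  exact congrArg (fun L : E n →L[ℝ] E n => L v) h

/-- The chart `B(0,1) → Γᵢ \ B(0,1)` with the Euclidean metric. -/
noncomputable def ballChart {n : ℕ} {ι : Type} (Γ : ι → Subgroup (E n ≃ₗᵢ[ℝ] E n))
    [∀ i, Finite (Γ i)] (i : ι) : OrbifoldChart n (BallQuotientSpace Γ) where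
  toRegularDomain := ballDomain n
  Grp := Γ i
  act γ := γ.1
  act_mem γ x hx := by
    rw [ballDomain_dom] at hx ⊢
    simpa using hx
  act_one _ _ := rfl
  act_mul _ _ _ _ := rfl
  act_smooth γ := γ.1.contDiff.contDiffOn
  act_effective γ h := by
    apply Subtype.ext
    apply LinearIsometryEquiv.ext
    intro x
    rw [ballDomain_dom] at h
    by_cases hx : x = 0
    · simp [hx]
    · have h0 : ‖x‖ ≠ 0 := norm_ne_zero_iff.mpr hx
      have h1 : γ.1 (‖x‖⁻¹ • x) = ‖x‖⁻¹ • x := h _ (by simp [norm_smul, h0])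
      rw [map_smul] at h1
      exact smul_right_injective _ (inv_ne_zero h0) h1
  proj := ballProj Γ i
  proj_continuousOn := by
    rw [ballDomain_dom, continuousOn_iff_continuous_domRestrict]
    have : (Metric.closedBall (0 : E n) 1).domRestrict (ballProj Γ i) =
        fun x : UnitBall n => ⟨i, Quotient.mk _ x⟩ := by
      funext x
      exact ballProj_of_mem Γ i x.2
    rw [this]
    exact continuous_sigmaMk.comp continuous_quot_mk
  proj_eq_iff x hx y hy := by
    rw [ballDomain_dom] at hx hy
    exact ballProj_eq_iff Γ i hx hy
  proj_isOpen W hW := by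
    have : ballProj Γ i '' (W ∩ (ballDomain n).dom) =
        Sigma.mk i '' (Quotient.mk (MulAction.orbitRel (Γ i) (UnitBall n)) ''
          (Subtype.val ⁻¹' W)) := by
      rw [ballDomain_dom]
      ext p
      constructor
      · rintro ⟨x, ⟨hxW, hx⟩, rfl⟩
        exact ⟨_, ⟨⟨x, hx⟩, hxW, rfl⟩, (ballProj_of_mem Γ i hx).symm⟩
      · rintro ⟨_, ⟨x, hxW, rfl⟩, rfl⟩
        exact ⟨x, ⟨hxW, x.2⟩, ballProj_of_mem Γ i x.2⟩
    rw [this]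
    exact isOpenMap_sigmaMk _ (isOpenMap_quotient_mk'_mul _ (hW.preimage continuous_subtype_val))
  metric _ := 1
  metric_smooth _ _ := contDiffOn_const
  metric_posDef _ _ := Matrix.PosDef.one
  metric_invariant γ x hx v w := by
    rw [fderivWithin_isometry γ.1 hx, fderivWithin_isometry γ.1 hx, metricForm_isometry]

/-- The flat orbifold `⊔ᵢ Γᵢ \ B(0,1)`, where the `Γᵢ` are finite subgroups of `O(n)` and `B(0,1)`
is the closed Euclidean unit ball in `ℝⁿ`. -/
noncomputable def ballQuotient {n : ℕ} {ι : Type} [Finite ι]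
    (Γ : ι → Subgroup (E n ≃ₗᵢ[ℝ] E n)) [∀ i, Finite (Γ i)] : CompactRiemannianOrbifold n :=
  haveI (i : ι) : SecondCountableTopology (MulAction.orbitRel.Quotient (Γ i) (UnitBall n)) :=
    ContinuousConstSMul.secondCountableTopology
  haveI (i : ι) : T2Space (MulAction.orbitRel.Quotient (Γ i) (UnitBall n)) :=
    t2Space_of_properlyDiscontinuousSMul_of_t2Space
  haveI (i : ι) : CompactSpace (MulAction.orbitRel.Quotient (Γ i) (UnitBall n)) :=
    Quotient.compactSpace
  { carrier := BallQuotientSpace Γ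
    ChartIndex := ι
    chart := ballChart Γ
    cover := by
      rintro ⟨i, q⟩
      induction q using Quotient.inductionOn with
      | _ x => exact ⟨i, x, (ballDomain_dom n).symm ▸ x.2, ballProj_of_mem Γ i x.2⟩
    compatible := by
      intro i j x hx y hy hxy
      have hij : i = j := congrArg Sigma.fst hxy
      subst hij
      obtain ⟨γ, hγ⟩ := ((ballChart Γ i).proj_eq_iff x hx y hy).1 hxy
      refine ⟨univ, univ, γ.1, γ.1.symm, isOpen_univ, mem_univ _, isOpen_univ, mem_univ _, hγ,
        ?_, ?_, ⟨fun z _ => γ.1.symm_apply_apply z, fun z _ => γ.1.apply_symm_apply z⟩,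
        γ.1.contDiff.contDiffOn, γ.1.symm.contDiff.contDiffOn, ?_, ?_⟩
      · exact fun z hz => ⟨mem_univ _, (ballChart Γ i).act_mem γ hz.2⟩
      · exact fun z hz => ⟨mem_univ _, (ballChart Γ i).act_mem γ⁻¹ hz.2⟩
      · intro z hz
        exact (((ballChart Γ i).proj_eq_iff z hz.2 _ ((ballChart Γ i).act_mem γ hz.2)).2
          ⟨γ, rfl⟩).symm
      · exact fun z hz v w => (ballChart Γ i).metric_invariant γ z hz.2 v w }

/-! ### Klein four-groups of sign changes -/

/-- The isometry of `ℝⁿ` which multiplies the `a`-th coordinate by the sign `s a`. -/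
noncomputable def signIsometry (n : ℕ) : (Fin n → ℤˣ) →* (E n ≃ₗᵢ[ℝ] E n) where
  toFun s := LinearIsometryEquiv.piLpCongrRight 2 fun a =>
    if s a = 1 then LinearIsometryEquiv.refl ℝ ℝ else LinearIsometryEquiv.neg ℝ
  map_one' := by
    ext x a
    simp
  map_mul' s t := by
    ext x a
    rcases Int.units_eq_one_or (s a) with h | h <;>
      rcases Int.units_eq_one_or (t a) with h' | h' <;> simp [h, h']

lemma signIsometry_apply {n : ℕ} (s : Fin n → ℤˣ) (x : E n) (a : Fin n) :
    signIsometry n s x a = ((s a : ℤ) : ℝ) * x a := by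
  rcases Int.units_eq_one_or (s a) with h | h <;> simp [signIsometry, h]

/-- The group of isometries `{1, σ}, {1, τ}, {1, στ}`, where `σ`, `τ` are the sign changes given by
`s`, `t`. -/
noncomputable def familyH {n : ℕ} (s t : Fin n → ℤˣ) (i : Fin 3) : Subgroup (E n ≃ₗᵢ[ℝ] E n) :=
  ((![Subgroup.zpowers s, Subgroup.zpowers t, Subgroup.zpowers (s * t)] :
    Fin 3 → Subgroup (Fin n → ℤˣ)) i).map (signIsometry n)

/-- The groups of isometries `{1}, G, G` with `G = {1, σ, τ, στ}`, where `σ`, `τ` are the sign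
changes given by `s`, `t`. -/
noncomputable def familyK {n : ℕ} (s t : Fin n → ℤˣ) (i : Fin 3) : Subgroup (E n ≃ₗᵢ[ℝ] E n) :=
  ((![⊥, Subgroup.closure {s, t}, Subgroup.closure {s, t}] :
    Fin 3 → Subgroup (Fin n → ℤˣ)) i).map (signIsometry n)

instance {n : ℕ} (s t : Fin n → ℤˣ) (i : Fin 3) : Finite (familyH s t i) :=
  (Set.toFinite (((![Subgroup.zpowers s, Subgroup.zpowers t, Subgroup.zpowers (s * t)] :
    Fin 3 → Subgroup (Fin n → ℤˣ)) i : Set (Fin n → ℤˣ)))).image (signIsometry n) |>.to_subtype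

instance {n : ℕ} (s t : Fin n → ℤˣ) (i : Fin 3) : Finite (familyK s t i) :=
  (Set.toFinite (((![⊥, Subgroup.closure {s, t}, Subgroup.closure {s, t}] :
    Fin 3 → Subgroup (Fin n → ℤˣ)) i : Set (Fin n → ℤˣ)))).image (signIsometry n) |>.to_subtype

/-- The orbifold `{1,σ} \ B(0,1) ⊔ {1,τ} \ B(0,1) ⊔ {1,στ} \ B(0,1)`. -/
noncomputable def orbifoldH {n : ℕ} (s t : Fin n → ℤˣ) : CompactRiemannianOrbifold n :=
  ballQuotient (familyH s t)

/-- The orbifold `B(0,1) ⊔ G \ B(0,1) ⊔ G \ B(0,1)` with `G = {1, σ, τ, στ}`. -/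
noncomputable def orbifoldK {n : ℕ} (s t : Fin n → ℤˣ) : CompactRiemannianOrbifold n :=
  ballQuotient (familyK s t)

end SteklovOrbifold

namespace SteklovOrbifold

/-! ### Sign changes and harmonic functions on the ball -/

/-! Lifting to the ball turns Steklov eigenfunctions of a quotient `Γ \ B` into `Γ`-invariant
Steklov functions of `B`. For a fixed eigenvalue, let `V` be the space of boundary values on the
unit sphere of Steklov functions of `B`. Composition with the two commuting involutions `σ`, `τ`
makes `V` a representation of the Klein four-group `G`. The eigenspaces of the two orbifolds are
`V^σ ⊕ V^τ ⊕ V^{στ}` and `V ⊕ V^G ⊕ V^G`. Split `V` by the signs with which `σ` and `τ` act: the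
first sum contains `V₊₊` three times and each of `V₊₋`, `V₋₊`, `V₋₋` once, and so does the second.

The proof realises this count by explicit mutually inverse maps, `transplant` and `transplantInv`,
so neither the eigenvalues nor finiteness of the multiplicities is needed. Uniqueness of harmonic
extensions is not needed either: the maps are applied simultaneously to boundary data and to a
chosen extension. This works because they use only values along `G`-orbits, which stay on the sphere
or off it. The bridge to the ball is `mem_map_boundaryPullback_iff`, and the result is
`steklovSpectrum_orbifoldH`.

For the boundary, each quotient ball contributes exactly one component, the image of the connected
sphere. It is singular exactly when some non-trivial group element fixes a unit vector, and a sign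
change does so as soon as one of its signs is `+1`. -/

lemma fderiv_comp_isometry {n : ℕ} (g : E n ≃ₗᵢ[ℝ] E n) (f : E n → ℝ) (x v : E n) :
    fderiv ℝ (fun y => f (g y)) x v = fderiv ℝ f (g x) (g v) :=
  congrArg (fun L : E n →L[ℝ] ℝ => L v)
    (g.toContinuousLinearEquiv.comp_right_fderiv (f := f) (x := x))

lemma mem_ballDomain_dom {n : ℕ} {x : E n} : x ∈ (ballDomain n).dom ↔ ‖x‖ ≤ 1 := by
  rw [ballDomain_dom, mem_closedBall_zero_iff]

lemma mem_ballDomain_inner {n : ℕ} {x : E n} : x ∈ (ballDomain n).inner ↔ ‖x‖ < 1 := by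
  simp [RegularDomain.inner, ballDomain]

lemma mem_ballDomain_bdry {n : ℕ} {x : E n} : x ∈ (ballDomain n).bdry ↔ ‖x‖ = 1 := by
  have h : (1 - ‖x‖ ^ 2 = 0) ↔ ‖x‖ = 1 := by
    rw [sub_eq_zero, eq_comm, pow_eq_one_iff_of_nonneg (norm_nonneg x) two_ne_zero]
  simpa [RegularDomain.bdry, ballDomain] using h

lemma fderivWithin_comp_isometry {n : ℕ} (g : E n ≃ₗᵢ[ℝ] E n) (f : E n → ℝ) {x : E n}
    (hx : x ∈ (ballDomain n).dom) (v : E n) :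
    fderivWithin ℝ (fun y => f (g y)) (ballDomain n).dom x v =
      fderivWithin ℝ f (ballDomain n).dom (g x) (g v) := by
  -- The ball is its own preimage under a linear isometry, so the chain rule does not change the set
  -- in which the derivative is taken.
  have hpre : g.toContinuousLinearEquiv ⁻¹' (ballDomain n).dom = (ballDomain n).dom := by
    ext y
    change g y ∈ (ballDomain n).dom ↔ _
    simp only [mem_ballDomain_dom, g.norm_map]
  have h := g.toContinuousLinearEquiv.comp_right_fderivWithin (f := f)
    (s := (ballDomain n).dom) (x := x) (by rw [hpre]; exact (ballDomain n).uniqueDiffOn x hx)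
  rw [hpre] at h
  exact congrArg (fun L : E n →L[ℝ] ℝ => L v) h

lemma laplaceBeltrami_one {n : ℕ} (f : E n → ℝ) (x : E n) :
    laplaceBeltrami (fun _ => 1) f x =
      ∑ a, fderiv ℝ (fun y => fderiv ℝ f y (stdVec a)) x (stdVec a) := by
  simp [laplaceBeltrami, Matrix.one_apply]

lemma signIsometry_stdVec {n : ℕ} (s : Fin n → ℤˣ) (a : Fin n) :
    signIsometry n s (stdVec a) = ((s a : ℤ) : ℝ) • stdVec a := by
  ext b
  rw [signIsometry_apply]
  by_cases h : b = a
  · subst h; simp [stdVec]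
  · simp [stdVec, h]

lemma unit_mul_self_real (u : ℤˣ) : ((u : ℤ) : ℝ) * ((u : ℤ) : ℝ) = 1 := by
  rcases Int.units_eq_one_or u with h | h <;> simp [h]

/-- Each `∂ₐ` picks up the sign `s a`, and the flat Laplacian contains every `∂ₐ` twice. -/
lemma laplaceBeltrami_comp_signIsometry {n : ℕ} (s : Fin n → ℤˣ) (f : E n → ℝ) (x : E n) :
    laplaceBeltrami (fun _ => 1) (fun y => f (signIsometry n s y)) x =
      laplaceBeltrami (fun _ => 1) f (signIsometry n s x) := by
  simp only [laplaceBeltrami_one]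
  refine Finset.sum_congr rfl fun a _ => ?_
  have h1 : (fun y => fderiv ℝ (fun z => f (signIsometry n s z)) y (stdVec a)) =
      ((s a : ℤ) : ℝ) • fun y => (fun z => fderiv ℝ f z (stdVec a)) (signIsometry n s y) := by
    funext y
    rw [fderiv_comp_isometry, signIsometry_stdVec, map_smul]
    rfl
  rw [h1, fderiv_const_smul_field, Pi.smul_apply, smul_apply,
    fderiv_comp_isometry (signIsometry n s) (fun z => fderiv ℝ f z (stdVec a)),
    signIsometry_stdVec, map_smul, smul_smul, unit_mul_self_real, one_smul]

/-- The function `1 - ‖x‖²` is invariant under isometries, so its partial derivatives and those of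
`f` pick up the same signs, which cancel in the products. -/
lemma normalDeriv_comp_signIsometry {n : ℕ} (s : Fin n → ℤˣ) (f : E n → ℝ) {x : E n}
    (hx : x ∈ (ballDomain n).dom) :
    (ballDomain n).normalDeriv (fun _ => 1) (fun y => f (signIsometry n s y)) x =
      (ballDomain n).normalDeriv (fun _ => 1) f (signIsometry n s x) := by
  have hρ : ∀ a, fderiv ℝ (ballDomain n).defFun x (stdVec a) =
      ((s a : ℤ) : ℝ) * fderiv ℝ (ballDomain n).defFun (signIsometry n s x) (stdVec a) := by
    intro a
    have h : (ballDomain n).defFun = fun y => (ballDomain n).defFun (signIsometry n s y) := by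
      funext y
      simp [ballDomain]
    conv_lhs => rw [h]
    rw [fderiv_comp_isometry, signIsometry_stdVec, map_smul, smul_eq_mul]
  have key : ∀ (a : Fin n) (u v : ℝ),
      ((s a : ℤ) : ℝ) * u * (((s a : ℤ) : ℝ) * v) = u * v := by
    intro a u v
    rw [mul_mul_mul_comm, unit_mul_self_real, one_mul]
  simp [RegularDomain.normalDeriv, Matrix.one_apply, fderivWithin_comp_isometry _ f hx,
    signIsometry_stdVec, hρ, key]

/-- The smooth functions on the closed unit ball (with arbitrary values outside of it) which are
harmonic and whose outward normal derivative on the unit sphere is `c` times their value. -/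
def steklovFunctions (n : ℕ) (c : ℝ) : Submodule ℝ (E n → ℝ) where
  carrier := {f | ContDiffOn ℝ ∞ f (ballDomain n).dom ∧
    (∀ x ∈ (ballDomain n).inner, laplaceBeltrami (fun _ => 1) f x = 0) ∧
    ∀ x ∈ (ballDomain n).bdry, (ballDomain n).normalDeriv (fun _ => 1) f x = c * f x}
  zero_mem' := by
    refine ⟨contDiffOn_const, fun x _ => ?_, fun x hx => ?_⟩
    · simpa using laplaceBeltrami_smul (fun _ => 1) 0 (0 : E n → ℝ) x
    · simpa using (ballDomain n).normalDeriv_smul (fun _ => 1) 0 (f := 0)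
        ((ballDomain n).bdry_subset_dom hx) contDiffOn_const
  add_mem' := by
    rintro f h ⟨hf1, hf2, hf3⟩ ⟨hh1, hh2, hh3⟩
    refine ⟨hf1.add hh1, fun x hx => ?_, fun x hx => ?_⟩
    · rw [laplaceBeltrami_add _ (hf1.contDiffAt ((ballDomain n).dom_mem_nhds hx))
        (hh1.contDiffAt ((ballDomain n).dom_mem_nhds hx)), hf2 x hx, hh2 x hx, add_zero]
    · rw [(ballDomain n).normalDeriv_add _ ((ballDomain n).bdry_subset_dom hx) hf1 hh1, hf3 x hx,
        hh3 x hx, Pi.add_apply, mul_add]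
  smul_mem' := by
    rintro k f ⟨hf1, hf2, hf3⟩
    refine ⟨contDiffOn_const.smul hf1, fun x hx => ?_, fun x hx => ?_⟩
    · rw [laplaceBeltrami_smul, hf2 x hx, mul_zero]
    · rw [(ballDomain n).normalDeriv_smul _ k ((ballDomain n).bdry_subset_dom hx) hf1, hf3 x hx,
        Pi.smul_apply, smul_eq_mul, mul_left_comm]

/-- This makes the Steklov functions of the ball a representation of the group of sign changes. -/
lemma steklovFunctions_comp_signIsometry {n : ℕ} {c : ℝ} (s : Fin n → ℤˣ) {f : E n → ℝ}
    (hf : f ∈ steklovFunctions n c) :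
    (fun x => f (signIsometry n s x)) ∈ steklovFunctions n c := by
  obtain ⟨h1, h2, h3⟩ := hf
  refine ⟨h1.comp (signIsometry n s).contDiff.contDiffOn fun x hx => ?_, fun x hx => ?_,
    fun x hx => ?_⟩
  · simpa [mem_ballDomain_dom] using hx
  · rw [laplaceBeltrami_comp_signIsometry]
    exact h2 _ (by simpa [mem_ballDomain_inner] using hx)
  · rw [normalDeriv_comp_signIsometry s f ((ballDomain n).bdry_subset_dom hx)]
    exact h3 _ (by simpa [mem_ballDomain_bdry] using hx)

/-- Membership does not see values outside the closed ball: the Laplacian is taken at interior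
points and the normal derivative uses derivatives within the ball. This absorbs the junk values of
`ballProj`. -/
lemma steklovFunctions_congr {n : ℕ} {c : ℝ} {f h : E n → ℝ} (hf : f ∈ steklovFunctions n c)
    (hfh : EqOn h f (ballDomain n).dom) : h ∈ steklovFunctions n c := by
  obtain ⟨h1, h2, h3⟩ := hf
  refine ⟨h1.congr hfh, fun x hx => ?_, fun x hx => ?_⟩
  · have e1 : h =ᶠ[𝓝 x] f :=
      Filter.eventuallyEq_of_mem ((ballDomain n).dom_mem_nhds hx) hfh
    have e2 : ∀ a : Fin n, (fun y => fderiv ℝ h y (stdVec a)) =ᶠ[𝓝 x]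
        fun y => fderiv ℝ f y (stdVec a) := fun a =>
      (e1.fderiv (𝕜 := ℝ)).mono fun y hy => congrArg (fun L : E n →L[ℝ] ℝ => L (stdVec a)) hy
    rw [← h2 x hx, laplaceBeltrami_one, laplaceBeltrami_one]
    exact Finset.sum_congr rfl fun a _ => by rw [(e2 a).fderiv_eq]
  · have hd := (ballDomain n).bdry_subset_dom hx
    rw [hfh hd, ← h3 x hx]
    simp only [RegularDomain.normalDeriv, fderivWithin_congr hfh (hfh hd)]

/-! ### Steklov eigenspaces of quotients of the ball -/

section Eigenspace

variable {n : ℕ} {ι : Type} [Finite ι] (Γ : ι → Subgroup (E n ≃ₗᵢ[ℝ] E n)) [∀ i, Finite (Γ i)]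

/-- The boundary point of `⊔ᵢ Γᵢ \ B(0,1)` represented by the point `x` of the `i`-th sphere. -/
noncomputable def boundaryPoint (i : ι) (x : E n) (hx : ‖x‖ = 1) : (ballQuotient Γ).boundary :=
  ⟨ballProj Γ i x, i, x, mem_ballDomain_bdry.2 hx, rfl⟩

open Classical in
/-- The pullback of functions on the boundary of `⊔ᵢ Γᵢ \ B(0,1)` to the unit sphere, extended by
zero to `ℝⁿ`. -/
noncomputable def boundaryPullback :
    ((ballQuotient Γ).boundary → ℝ) →ₗ[ℝ] (ι → E n → ℝ) where
  toFun u i x := if hx : ‖x‖ = 1 then u (boundaryPoint Γ i x hx) else 0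
  map_add' u v := by
    funext i x
    by_cases hx : ‖x‖ = 1 <;> simp [hx]
  map_smul' c u := by
    funext i x
    by_cases hx : ‖x‖ = 1 <;> simp [hx]

lemma boundaryPullback_of_norm_eq (u : (ballQuotient Γ).boundary → ℝ) (i : ι) {x : E n}
    (hx : ‖x‖ = 1) :
    boundaryPullback Γ u i x = u (boundaryPoint Γ i x hx) := by
  simp [boundaryPullback, hx]

lemma boundaryPullback_of_norm_ne (u : (ballQuotient Γ).boundary → ℝ) (i : ι) {x : E n}
    (hx : ‖x‖ ≠ 1) : boundaryPullback Γ u i x = 0 := by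
  simp [boundaryPullback, hx]

lemma exists_eq_boundaryPoint (p : (ballQuotient Γ).boundary) :
    ∃ (i : ι) (x : E n) (hx : ‖x‖ = 1), p = boundaryPoint Γ i x hx := by
  obtain ⟨_, i, x, hx, rfl⟩ := p
  exact ⟨i, x, mem_ballDomain_bdry.1 hx, rfl⟩

lemma boundaryPullback_injective : Function.Injective (boundaryPullback Γ) := by
  intro u v h
  funext p
  obtain ⟨i, x, hx, rfl⟩ := exists_eq_boundaryPoint Γ p
  rw [← boundaryPullback_of_norm_eq Γ u, ← boundaryPullback_of_norm_eq Γ v, h]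

omit [Finite ι] [∀ i, Finite (Γ i)] in
-- Outside the ball both sides are the same junk value, because `γ` preserves the norm. Lifts are
-- therefore invariant on all of `ℝⁿ`.
lemma ballProj_apply_of_mem {i : ι} {γ : E n ≃ₗᵢ[ℝ] E n} (hγ : γ ∈ Γ i) (x : E n) :
    ballProj Γ i (γ x) = ballProj Γ i x := by
  by_cases hx : x ∈ Metric.closedBall (0 : E n) 1
  · have hγx : γ x ∈ Metric.closedBall (0 : E n) 1 := by simpa using hx
    exact ((ballProj_eq_iff Γ i hx hγx).2 ⟨⟨γ, hγ⟩, rfl⟩).symm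
  · have hγx : γ x ∉ Metric.closedBall (0 : E n) 1 := by simpa using hx
    simp only [ballProj, dif_neg hx, dif_neg hγx]

/-- A family of functions on the unit ball, the `i`-th of which is `Γᵢ`-invariant, descends to
`⊔ᵢ Γᵢ \ B(0,1)`. -/
noncomputable def descend (F : ι → E n → ℝ) (hF : ∀ i, ∀ γ ∈ Γ i, ∀ x, F i (γ x) = F i x)
    (p : BallQuotientSpace Γ) : ℝ :=
  Quotient.lift (fun x : UnitBall n => F p.1 x) (by
    rintro a b ⟨γ, rfl⟩
    exact hF p.1 γ.1 γ.2 b) p.2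

omit [Finite ι] [∀ i, Finite (Γ i)] in
lemma descend_ballProj {F : ι → E n → ℝ} (hF : ∀ i, ∀ γ ∈ Γ i, ∀ x, F i (γ x) = F i x)
    (i : ι) {x : E n} (hx : x ∈ (ballDomain n).dom) :
    descend Γ F hF (ballProj Γ i x) = F i x := by
  rw [ballProj_of_mem Γ i (by rwa [ballDomain_dom] at hx)]
  rfl

lemma mem_steklovEigenspace_iff (c : ℝ) (u : (ballQuotient Γ).boundary → ℝ) :
    u ∈ (ballQuotient Γ).steklovEigenspace c ↔ ∃ f : (ballQuotient Γ).carrier → ℝ,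
      (∀ p : (ballQuotient Γ).boundary, f p = u p) ∧
      ∀ i, f ∘ ballProj Γ i ∈ steklovFunctions n c := by
  constructor
  · rintro ⟨f, h1, h2, h3, h4⟩
    refine ⟨f, h3, fun i => ⟨h1 i, h2 i, fun x hx => ?_⟩⟩
    refine (h4 i x hx).trans ?_
    exact congrArg (c * ·) (h3 ⟨ballProj Γ i x, i, x, hx, rfl⟩).symm
  · rintro ⟨f, h3, h⟩
    refine ⟨f, fun i => (h i).1, fun i => (h i).2.1, h3, fun i x hx => ?_⟩
    refine ((h i).2.2 x hx).trans ?_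
    exact congrArg (c * ·) (h3 ⟨ballProj Γ i x, i, x, hx, rfl⟩)

/-- Lifting an eigenfunction gives invariant functions `F i`, and conversely an invariant family
descends to the quotient. The eigenspaces of different quotients thereby become subspaces of one
space `ι → E n → ℝ`, where they can be compared. -/
lemma mem_map_boundaryPullback_iff (c : ℝ) (w : ι → E n → ℝ) :
    w ∈ ((ballQuotient Γ).steklovEigenspace c).map (boundaryPullback Γ) ↔
      (∀ i x, ‖x‖ ≠ 1 → w i x = 0) ∧ ∃ F : ι → E n → ℝ,
        (∀ i, F i ∈ steklovFunctions n c) ∧ (∀ i, ∀ γ ∈ Γ i, ∀ x, F i (γ x) = F i x) ∧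
        ∀ i x, ‖x‖ = 1 → w i x = F i x := by
  constructor
  · rintro ⟨u, hu, rfl⟩
    obtain ⟨f, hfu, hf⟩ := (mem_steklovEigenspace_iff Γ c u).1 hu
    refine ⟨fun i x => boundaryPullback_of_norm_ne Γ u i, fun i => f ∘ ballProj Γ i, hf,
      fun i γ hγ x => congrArg f (ballProj_apply_of_mem Γ hγ x), fun i x hx => ?_⟩
    rw [boundaryPullback_of_norm_eq Γ u i hx]
    exact (hfu _).symm
  · rintro ⟨h0, F, hF, hinv, hw⟩
    refine ⟨fun p => descend Γ F hinv p.1, (mem_steklovEigenspace_iff Γ c _).2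
      ⟨descend Γ F hinv, fun _ => rfl, fun i => steklovFunctions_congr (hF i) fun x hx =>
        descend_ballProj Γ hinv i hx⟩, ?_⟩
    funext i x
    by_cases hx : ‖x‖ = 1
    · rw [boundaryPullback_of_norm_eq Γ _ i hx, hw i x hx]
      exact descend_ballProj Γ hinv i (mem_ballDomain_dom.2 hx.le)
    · rw [boundaryPullback_of_norm_ne Γ _ i hx, h0 i x hx]

lemma steklovSpectrum_ballQuotient (c : ℝ) :
    (ballQuotient Γ).steklovSpectrum c =
      Module.rank ℝ (((ballQuotient Γ).steklovEigenspace c).map (boundaryPullback Γ)) :=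
  (Submodule.equivMapOfInjective _ (boundaryPullback_injective Γ) _).rank_eq

end Eigenspace

/-! ### Transplantation -/

/-- Transplantation of a triple of functions invariant under `s`, `t`, `s ∘ t`, respectively, to a
triple of functions the last two of which are invariant under both of `s` and `t`. -/
noncomputable def transplant {X : Type} (s : X → X) : (Fin 3 → X → ℝ) →ₗ[ℝ] (Fin 3 → X → ℝ) where
  toFun f := ![f 0 + (1 / 2 : ℝ) • (f 1 - f 1 ∘ s) + (1 / 2 : ℝ) • (f 2 - f 2 ∘ s),
    (1 / 2 : ℝ) • (f 1 + f 1 ∘ s), (1 / 2 : ℝ) • (f 2 + f 2 ∘ s)]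
  map_add' f h := by
    ext i x
    fin_cases i <;> simp <;> ring
  map_smul' c f := by
    ext i x
    fin_cases i <;> simp <;> ring

/-- The inverse transplantation. -/
noncomputable def transplantInv {X : Type} (s t : X → X) :
    (Fin 3 → X → ℝ) →ₗ[ℝ] (Fin 3 → X → ℝ) where
  toFun g := ![(1 / 2 : ℝ) • (g 0 + g 0 ∘ s),
    g 1 + (1 / 4 : ℝ) • (g 0 + g 0 ∘ t - g 0 ∘ s - (g 0 ∘ t) ∘ s),
    g 2 + (1 / 4 : ℝ) • (g 0 + (g 0 ∘ t) ∘ s - g 0 ∘ s - g 0 ∘ t)]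
  map_add' f h := by
    ext i x
    fin_cases i <;> simp <;> ring
  map_smul' c f := by
    ext i x
    fin_cases i <;> simp <;> ring

section Transplant

variable {X : Type} {s t : X → X}

/-- Invariance under `s`, `t`, `s ∘ t` of the three components. -/
def IsInvariantH (s t : X → X) (f : Fin 3 → X → ℝ) : Prop :=
  (∀ x, f 0 (s x) = f 0 x) ∧ (∀ x, f 1 (t x) = f 1 x) ∧ ∀ x, f 2 (s (t x)) = f 2 x

/-- Invariance of the last two components under `s` and `t`. -/
def IsInvariantK (s t : X → X) (g : Fin 3 → X → ℝ) : Prop :=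
  ∀ i, i ≠ 0 → (∀ x, g i (s x) = g i x) ∧ ∀ x, g i (t x) = g i x

/-- Averaging over `s` produces `s`-invariance. The average of `f 1` stays `t`-invariant because `s`
and `t` commute; in that of `f 2`, the map `t` swaps the two summands, since `f 2 ∘ t = f 2 ∘ s`. -/
lemma IsInvariantH.transplant (hs : ∀ x, s (s x) = x)
    (hst : ∀ x, t (s x) = s (t x)) {f : Fin 3 → X → ℝ} (hf : IsInvariantH s t f) :
    IsInvariantK s t (transplant s f) := by
  obtain ⟨-, h1, h2⟩ := hf
  have h2' : ∀ x, f 2 (t x) = f 2 (s x) := fun x => by rw [← h2 (s x), hst, hs]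
  intro i hi
  fin_cases i
  · exact absurd rfl hi
  · refine ⟨fun x => ?_, fun x => ?_⟩ <;>
      simp [SteklovOrbifold.transplant, hs, h1, ← hst, add_comm]
  · refine ⟨fun x => ?_, fun x => ?_⟩ <;>
      simp [SteklovOrbifold.transplant, hs, h2, h2', add_comm]

/-- The terms built from `g 0` are its projections onto the `s`-even part, the `s`-odd `t`-even part
and the part odd under both; these are invariant under `s`, `t` and `s ∘ t`, respectively. -/
lemma IsInvariantK.transplantInv (hs : ∀ x, s (s x) = x) (ht : ∀ x, t (t x) = x)
    (hst : ∀ x, t (s x) = s (t x)) {g : Fin 3 → X → ℝ} (hg : IsInvariantK s t g) :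
    IsInvariantH s t (transplantInv s t g) := by
  obtain ⟨h1s, h1t⟩ := hg 1 (by decide)
  obtain ⟨h2s, h2t⟩ := hg 2 (by decide)
  refine ⟨fun x => ?_, fun x => ?_, fun x => ?_⟩ <;>
    simp [SteklovOrbifold.transplantInv, hs, ht, hst, h1t, h2s, h2t] <;> ring

/-- In slot 0 of the transplant, the `s`-odd parts of `f 1` and `f 2` are told apart by their parity
under `t`: even for `f 1`, odd for `f 2`. The projections in `transplantInv` therefore return each
to its own slot. -/
lemma transplantInv_transplant (hs : ∀ x, s (s x) = x)
    (hst : ∀ x, t (s x) = s (t x)) {f : Fin 3 → X → ℝ} (hf : IsInvariantH s t f) :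
    transplantInv s t (transplant s f) = f := by
  obtain ⟨h0, h1, h2⟩ := hf
  have h2' : ∀ x, f 2 (t x) = f 2 (s x) := fun x => by rw [← h2 (s x), hst, hs]
  have h1' : ∀ x, f 1 (s (t x)) = f 1 (s x) := fun x => by rw [← hst, h1]
  ext i x
  fin_cases i <;> simp [transplant, transplantInv, hs, hst, h0, h1, h2, h2', h1'] <;> ring

lemma transplant_transplantInv (hs : ∀ x, s (s x) = x)
    (hst : ∀ x, t (s x) = s (t x)) {g : Fin 3 → X → ℝ} (hg : IsInvariantK s t g) :
    transplant s (transplantInv s t g) = g := by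
  obtain ⟨h1s, -⟩ := hg 1 (by decide)
  obtain ⟨h2s, -⟩ := hg 2 (by decide)
  ext i x
  fin_cases i <;> simp [transplant, transplantInv, hs, hst, h1s, h2s] <;> ring

lemma transplant_mem {P : Submodule ℝ (X → ℝ)} (hs : ∀ f ∈ P, f ∘ s ∈ P) {f : Fin 3 → X → ℝ}
    (hf : ∀ i, f i ∈ P) (i : Fin 3) : transplant s f i ∈ P := by
  have h (j : Fin 3) := hs _ (hf j)
  fin_cases i
  · exact P.add_mem (P.add_mem (hf 0) (P.smul_mem _ (P.sub_mem (hf 1) (h 1))))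
      (P.smul_mem _ (P.sub_mem (hf 2) (h 2)))
  · exact P.smul_mem _ (P.add_mem (hf 1) (h 1))
  · exact P.smul_mem _ (P.add_mem (hf 2) (h 2))

lemma transplantInv_mem {P : Submodule ℝ (X → ℝ)} (hs : ∀ f ∈ P, f ∘ s ∈ P)
    (ht : ∀ f ∈ P, f ∘ t ∈ P) {g : Fin 3 → X → ℝ} (hg : ∀ i, g i ∈ P) (i : Fin 3) :
    transplantInv s t g i ∈ P := by
  have h1 := hs _ (hg 0)
  have h2 := ht _ (hg 0)
  have h3 := hs _ h2
  fin_cases i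
  · exact P.smul_mem _ (P.add_mem (hg 0) h1)
  · exact P.add_mem (hg 1)
      (P.smul_mem _ (P.sub_mem (P.sub_mem (P.add_mem (hg 0) h2) h1) h3))
  · exact P.add_mem (hg 2)
      (P.smul_mem _ (P.sub_mem (P.sub_mem (P.add_mem (hg 0) h3) h1) h2))

/-- Used with `A` the unit sphere, to compare boundary data with extensions, and with `A` its
complement, to keep the extension by zero. -/
lemma transplant_eqOn {A : Set X} (hs : MapsTo s A A) {f h : Fin 3 → X → ℝ}
    (hfh : ∀ i, ∀ x ∈ A, f i x = h i x) (i : Fin 3) (x : X) (hx : x ∈ A) :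
    transplant s f i x = transplant s h i x := by
  fin_cases i <;> simp [transplant, hfh _ x hx, hfh _ _ (hs hx)]

lemma transplantInv_eqOn {A : Set X} (hs : MapsTo s A A) (ht : MapsTo t A A)
    {f h : Fin 3 → X → ℝ} (hfh : ∀ i, ∀ x ∈ A, f i x = h i x) (i : Fin 3) (x : X) (hx : x ∈ A) :
    transplantInv s t f i x = transplantInv s t h i x := by
  fin_cases i <;> simp [transplantInv, hfh _ x hx, hfh _ _ (hs hx), hfh _ _ (ht hx),
    hfh _ _ (ht (hs hx))]

end Transplant

/-- Two submodules which are mapped into each other by mutually inverse linear maps have the same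
rank. -/
lemma rank_eq_of_inverse {M N : Type} [AddCommGroup M] [Module ℝ M] [AddCommGroup N] [Module ℝ N]
    {p : Submodule ℝ M} {q : Submodule ℝ N} (T : M →ₗ[ℝ] N) (S : N →ₗ[ℝ] M)
    (hT : ∀ x ∈ p, T x ∈ q) (hS : ∀ y ∈ q, S y ∈ p) (hST : ∀ x ∈ p, S (T x) = x)
    (hTS : ∀ y ∈ q, T (S y) = y) : Module.rank ℝ p = Module.rank ℝ q :=
  (LinearEquiv.ofLinearMap (T.restrict hT) (S.restrict hS)
    (LinearMap.ext fun y => Subtype.ext (hTS y y.2))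
    (LinearMap.ext fun x => Subtype.ext (hST x x.2))).rank_eq

/-! ### Isospectrality -/

lemma forall_mem_map_closure_iff {n : ℕ} (S : Set (Fin n → ℤˣ)) (f : E n → ℝ) :
    (∀ γ ∈ (Subgroup.closure S).map (signIsometry n), ∀ x, f (γ x) = f x) ↔
      ∀ s ∈ S, ∀ x, f (signIsometry n s x) = f x := by
  constructor
  · exact fun h s hs => h _ (Subgroup.mem_map_of_mem _ (Subgroup.subset_closure hs))
  · rintro h _ ⟨r, hr, rfl⟩
    induction hr using Subgroup.closure_induction with
    | mem s hs => exact h s hs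
    | one => intro x; rw [map_one]; rfl
    | mul a b _ _ ha hb =>
      intro x
      rw [map_mul]
      exact (ha _).trans (hb x)
    | inv a _ ha =>
      intro x
      rw [← ha, map_inv]
      exact congrArg f ((signIsometry n a).apply_symm_apply x)

lemma signIsometry_signIsometry {n : ℕ} (s t : Fin n → ℤˣ) (x : E n) :
    signIsometry n s (signIsometry n t x) = signIsometry n (s * t) x := by
  rw [map_mul]; rfl

lemma signIsometry_self {n : ℕ} (s : Fin n → ℤˣ) (x : E n) :
    signIsometry n s (signIsometry n s x) = x := by
  rw [signIsometry_signIsometry, show s * s = 1 from funext fun a => Int.units_mul_self (s a),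
    map_one]
  rfl

lemma signIsometry_comm {n : ℕ} (s t : Fin n → ℤˣ) (x : E n) :
    signIsometry n t (signIsometry n s x) = signIsometry n s (signIsometry n t x) := by
  rw [signIsometry_signIsometry, signIsometry_signIsometry, mul_comm]

lemma forall_familyH_iff {n : ℕ} (s t : Fin n → ℤˣ) (f : Fin 3 → E n → ℝ) :
    (∀ i, ∀ γ ∈ familyH s t i, ∀ x, f i (γ x) = f i x) ↔
      IsInvariantH (signIsometry n s) (signIsometry n t) f := by
  have h0 := forall_mem_map_closure_iff {s} (f 0)
  have h1 := forall_mem_map_closure_iff {t} (f 1)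
  have h2 := forall_mem_map_closure_iff {s * t} (f 2)
  rw [← Subgroup.zpowers_eq_closure] at h0 h1 h2
  rw [Fin.forall_fin_succ, Fin.forall_fin_two, IsInvariantH]
  refine and_congr (h0.trans (by simp)) (and_congr (h1.trans (by simp)) (h2.trans ?_))
  simp only [mem_singleton_iff, forall_eq, signIsometry_signIsometry]

lemma forall_familyK_iff {n : ℕ} (s t : Fin n → ℤˣ) (f : Fin 3 → E n → ℝ) :
    (∀ i, ∀ γ ∈ familyK s t i, ∀ x, f i (γ x) = f i x) ↔
      IsInvariantK (signIsometry n s) (signIsometry n t) f := by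
  -- The trivial group is the closure of the empty set, so the first slot carries no condition.
  have h0 := forall_mem_map_closure_iff ∅ (f 0)
  have h1 := forall_mem_map_closure_iff {s, t} (f 1)
  have h2 := forall_mem_map_closure_iff {s, t} (f 2)
  rw [Subgroup.closure_empty] at h0
  rw [Fin.forall_fin_succ, Fin.forall_fin_two, IsInvariantK, Fin.forall_fin_succ,
    Fin.forall_fin_two]
  refine and_congr (h0.trans (by simp)) (and_congr (h1.trans ?_) (h2.trans ?_))
  · simp
  · simp

/-- The orbifolds `orbifoldH s t` and `orbifoldK s t` are Steklov isospectral. -/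
theorem steklovSpectrum_orbifoldH {n : ℕ} (s t : Fin n → ℤˣ) :
    (orbifoldH s t).steklovSpectrum = (orbifoldK s t).steklovSpectrum := by
  funext c
  have hs := signIsometry_self s
  have ht := signIsometry_self t
  have hst := signIsometry_comm s t
  have hsph (r : Fin n → ℤˣ) : MapsTo (signIsometry n r) {x | ‖x‖ = 1} {x | ‖x‖ = 1} :=
    fun x hx => by simpa using hx
  have hsph' (r : Fin n → ℤˣ) : MapsTo (signIsometry n r) {x | ‖x‖ ≠ 1} {x | ‖x‖ ≠ 1} :=
    fun x hx => by simpa using hx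
  have hP (r : Fin n → ℤˣ) (f) (hf : f ∈ steklovFunctions n c) :=
    steklovFunctions_comp_signIsometry r hf
  -- The boundary data inherit invariance from the extension on the sphere and vanish elsewhere. The
  -- two inverse identities hold only for invariant triples, so they need this.
  have hinv {f F : Fin 3 → E n → ℝ} (h0 : ∀ i x, ‖x‖ ≠ 1 → f i x = 0)
      (h1 : ∀ i x, ‖x‖ = 1 → f i x = F i x) (r : Fin n → ℤˣ) {i : Fin 3}
      (hF : ∀ x, F i (signIsometry n r x) = F i x) (x : E n) :
      f i (signIsometry n r x) = f i x := by
    by_cases hx : ‖x‖ = 1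
    · rw [h1 i _ (hsph r hx), h1 i x hx, hF]
    · rw [h0 i _ (hsph' r hx), h0 i x hx]
  have hH {f F : Fin 3 → E n → ℝ} (h0 : ∀ i x, ‖x‖ ≠ 1 → f i x = 0)
      (h1 : ∀ i x, ‖x‖ = 1 → f i x = F i x)
      (hF : ∀ i, ∀ γ ∈ familyH s t i, ∀ x, F i (γ x) = F i x) :
      IsInvariantH (signIsometry n s) (signIsometry n t) f := by
    rw [← forall_familyH_iff]
    rintro i _ ⟨r, hr, rfl⟩
    exact hinv h0 h1 r (hF i _ ⟨r, hr, rfl⟩)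
  have hK {f F : Fin 3 → E n → ℝ} (h0 : ∀ i x, ‖x‖ ≠ 1 → f i x = 0)
      (h1 : ∀ i x, ‖x‖ = 1 → f i x = F i x)
      (hF : ∀ i, ∀ γ ∈ familyK s t i, ∀ x, F i (γ x) = F i x) :
      IsInvariantK (signIsometry n s) (signIsometry n t) f := by
    rw [← forall_familyK_iff]
    rintro i _ ⟨r, hr, rfl⟩
    exact hinv h0 h1 r (hF i _ ⟨r, hr, rfl⟩)
  rw [orbifoldH, orbifoldK, steklovSpectrum_ballQuotient, steklovSpectrum_ballQuotient]
  refine rank_eq_of_inverse (transplant (signIsometry n s))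
    (transplantInv (signIsometry n s) (signIsometry n t)) ?_ ?_ ?_ ?_
  · intro f hf
    rw [mem_map_boundaryPullback_iff] at hf ⊢
    obtain ⟨h0, F, hF, hFi, h1⟩ := hf
    refine ⟨fun i x hx => ?_, transplant (signIsometry n s) F, transplant_mem (hP s) hF,
      (forall_familyK_iff s t _).2 (((forall_familyH_iff s t F).1 hFi).transplant hs hst),
      transplant_eqOn (hsph s) h1⟩
    rw [transplant_eqOn (h := 0) (hsph' s) h0 i x hx, map_zero]
    rfl
  · intro f hf
    rw [mem_map_boundaryPullback_iff] at hf ⊢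
    obtain ⟨h0, F, hF, hFi, h1⟩ := hf
    refine ⟨fun i x hx => ?_, transplantInv (signIsometry n s) (signIsometry n t) F,
      transplantInv_mem (hP s) (hP t) hF,
      (forall_familyH_iff s t _).2 (((forall_familyK_iff s t F).1 hFi).transplantInv hs ht hst),
      transplantInv_eqOn (hsph s) (hsph t) h1⟩
    rw [transplantInv_eqOn (h := 0) (hsph' s) (hsph' t) h0 i x hx, map_zero]
    rfl
  · intro f hf
    obtain ⟨h0, F, -, hFi, h1⟩ := (mem_map_boundaryPullback_iff _ c f).1 hf
    exact transplantInv_transplant hs hst (hH h0 h1 hFi)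
  · intro f hf
    obtain ⟨h0, F, -, hFi, h1⟩ := (mem_map_boundaryPullback_iff _ c f).1 hf
    exact transplant_transplantInv hs hst (hK h0 h1 hFi)

/-! ### Boundary components -/

section Components

variable {n : ℕ} {ι : Type} [Finite ι] (Γ : ι → Subgroup (E n ≃ₗᵢ[ℝ] E n)) [∀ i, Finite (Γ i)]

lemma isPreconnected_unitSphere (hn : 2 ≤ n) : IsPreconnected {x : E n | ‖x‖ = 1} := by
  have h : 1 < Module.rank ℝ (E n) := by
    rw [← Module.finrank_eq_rank, finrank_euclideanSpace_fin]
    exact_mod_cast hn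
  have := isPreconnected_sphere h (0 : E n) 1
  rwa [show Metric.sphere (0 : E n) 1 = {x : E n | ‖x‖ = 1} by ext x; simp] at this

lemma exists_norm_eq_one (hn : 2 ≤ n) : ∃ x : E n, ‖x‖ = 1 :=
  ⟨stdVec ⟨0, by omega⟩, by simp [stdVec]⟩

/-- The index of the summand is locally constant, so it separates components; within one summand the
boundary is a continuous image of the connected sphere. -/
lemma connectedComponents_mk_eq_iff (hn : 2 ≤ n) (p q : (ballQuotient Γ).boundary) :
    ConnectedComponents.mk p = ConnectedComponents.mk q ↔
      (p.1 : BallQuotientSpace Γ).1 = (q.1 : BallQuotientSpace Γ).1 := by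
  constructor
  · intro h
    have hclopen : IsClopen {r : BallQuotientSpace Γ | r.1 = (q.1 : BallQuotientSpace Γ).1} := by
      have hopen : ∀ T : Set ι, IsOpen {r : BallQuotientSpace Γ | r.1 ∈ T} := by
        intro T
        rw [isOpen_sigma_iff]
        intro i
        by_cases hi : i ∈ T
        · convert isOpen_univ using 1
          ext; simp [hi]
        · convert isOpen_empty using 1
          ext; simp [hi]
      exact ⟨⟨hopen {(q.1 : BallQuotientSpace Γ).1}ᶜ⟩, hopen {(q.1 : BallQuotientSpace Γ).1}⟩
    have h1 : IsClopen ((Subtype.val : (ballQuotient Γ).boundary → (ballQuotient Γ).carrier) ⁻¹'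
        {r : BallQuotientSpace Γ | r.1 = (q.1 : BallQuotientSpace Γ).1}) :=
      hclopen.preimage continuous_subtype_val
    exact h1.connectedComponent_subset rfl (ConnectedComponents.coe_eq_coe'.1 h)
  · intro h
    obtain ⟨i, x, hx, rfl⟩ := exists_eq_boundaryPoint Γ p
    obtain ⟨j, y, hy, rfl⟩ := exists_eq_boundaryPoint Γ q
    obtain rfl : i = j := h
    have hcont : Continuous fun z : {z : E n | ‖z‖ = 1} => boundaryPoint Γ i z.1 z.2 := by
      refine Continuous.subtype_mk ?_ _
      refine (ballChart Γ i).proj_continuousOn.comp_continuous continuous_subtype_val fun z => ?_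
      exact mem_ballDomain_dom.2 z.2.le
    have := isPreconnected_iff_preconnectedSpace.1 (isPreconnected_unitSphere hn)
    have hpre := isPreconnected_range hcont
    exact ConnectedComponents.coe_eq_coe'.2
      (hpre.subset_connectedComponent ⟨⟨y, hy⟩, rfl⟩ ⟨⟨x, hx⟩, rfl⟩)

lemma exists_isSingular_iff (i : ι) :
    (∃ p : (ballQuotient Γ).boundary, (p.1 : BallQuotientSpace Γ).1 = i ∧
      (ballQuotient Γ).IsSingular p) ↔ ∃ γ ∈ Γ i, γ ≠ 1 ∧ ∃ x : E n, ‖x‖ = 1 ∧ γ x = x := by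
  constructor
  · rintro ⟨p, rfl, j, x, hx, hxp, γ, hγ, hγx⟩
    obtain ⟨k, y, hy, rfl⟩ := exists_eq_boundaryPoint Γ p
    have hxy : ballProj Γ j x = ballProj Γ k y := hxp
    obtain rfl : j = k := congrArg Sigma.fst hxy
    -- The lift `x` with isotropy need not be the chosen lift `y`, but an isometry carries one to
    -- the other, so `x` also has norm one.
    obtain ⟨δ, hδ⟩ := ((ballChart Γ j).proj_eq_iff x hx y (mem_ballDomain_dom.2 hy.le)).1 hxy
    refine ⟨γ.1, γ.2, fun h => hγ (Subtype.ext h), x, ?_, hγx⟩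
    rw [← hy, ← hδ]
    exact (δ.1.norm_map x).symm
  · rintro ⟨γ, hγ, h1, x, hx, hγx⟩
    exact ⟨boundaryPoint Γ i x hx, rfl, i, x, mem_ballDomain_dom.2 hx.le, rfl, ⟨γ, hγ⟩,
      fun h => h1 (congrArg Subtype.val h), hγx⟩

/-- The boundary components of `⊔ᵢ Γᵢ \ B(0,1)` correspond to the indices `i`. -/
noncomputable def connectedComponentsBoundaryEquiv (hn : 2 ≤ n) :
    ConnectedComponents (ballQuotient Γ).boundary ≃ ι := by
  refine Equiv.ofBijective (Quotient.lift (fun p : (ballQuotient Γ).boundary =>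
    (p.1 : BallQuotientSpace Γ).1) fun p q h =>
      (connectedComponents_mk_eq_iff Γ hn p q).1 (Quotient.sound h)) ⟨?_, fun i => ?_⟩
  · rintro ⟨p⟩ ⟨q⟩ h
    exact (connectedComponents_mk_eq_iff Γ hn p q).2 h
  · obtain ⟨x, hx⟩ := exists_norm_eq_one hn
    exact ⟨ConnectedComponents.mk (boundaryPoint Γ i x hx), rfl⟩

lemma connectedComponentsBoundaryEquiv_mk (hn : 2 ≤ n) (p : (ballQuotient Γ).boundary) :
    connectedComponentsBoundaryEquiv Γ hn (ConnectedComponents.mk p) =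
      (p.1 : BallQuotientSpace Γ).1 := rfl

lemma numSingularBoundaryComponents_ballQuotient (hn : 2 ≤ n) :
    (ballQuotient Γ).numSingularBoundaryComponents =
      ENat.card {i // ∃ γ ∈ Γ i, γ ≠ 1 ∧ ∃ x : E n, ‖x‖ = 1 ∧ γ x = x} := by
  refine ENat.card_congr ((connectedComponentsBoundaryEquiv Γ hn).subtypeEquiv fun c => ?_)
  rw [← exists_isSingular_iff]
  refine exists_congr fun p => and_congr_left fun _ => ?_
  rw [← connectedComponentsBoundaryEquiv_mk Γ hn, EmbeddingLike.apply_eq_iff_eq]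

lemma numSmoothBoundaryComponents_ballQuotient (hn : 2 ≤ n) :
    (ballQuotient Γ).numSmoothBoundaryComponents =
      ENat.card {i // ¬ ∃ γ ∈ Γ i, γ ≠ 1 ∧ ∃ x : E n, ‖x‖ = 1 ∧ γ x = x} := by
  refine ENat.card_congr ((connectedComponentsBoundaryEquiv Γ hn).subtypeEquiv fun c => ?_)
  rw [← exists_isSingular_iff, not_exists]
  refine forall_congr' fun p => ?_
  rw [not_and, ← connectedComponentsBoundaryEquiv_mk Γ hn, EmbeddingLike.apply_eq_iff_eq]

end Components

lemma exists_fixed_of_mem_map {n : ℕ} {G : Subgroup (Fin n → ℤˣ)} {r : Fin n → ℤˣ} (hr : r ∈ G)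
    (hr1 : r ≠ 1) {a : Fin n} (ha : r a = 1) :
    ∃ γ ∈ G.map (signIsometry n), γ ≠ 1 ∧ ∃ x : E n, ‖x‖ = 1 ∧ γ x = x := by
  refine ⟨_, Subgroup.mem_map_of_mem _ hr, fun h => hr1 ?_, stdVec a, by simp [stdVec], ?_⟩
  -- Evaluating at the basis vector `stdVec b` recovers the sign `r b`, so only the trivial sign
  -- pattern gives the identity.
  · funext b
    have hb : signIsometry n r (stdVec b) b = stdVec b b := by rw [h]; rfl
    rw [signIsometry_apply] at hb
    simpa [stdVec] using hb
  · ext b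
    rw [signIsometry_apply]
    by_cases hb : b = a
    · simp [hb, ha]
    · simp [stdVec, hb]

/-- The numbers of smooth and of singular boundary components of `orbifoldH s t` and
`orbifoldK s t`. -/
theorem card_boundaryComponents {n : ℕ} (hn : 2 ≤ n) {s t : Fin n → ℤˣ} (hs : s ≠ 1) (ht : t ≠ 1)
    (hst : s * t ≠ 1) {a b c : Fin n} (ha : s a = 1) (hb : t b = 1) (hc : (s * t) c = 1) :
    (orbifoldH s t).numSmoothBoundaryComponents = 0 ∧
    (orbifoldH s t).numSingularBoundaryComponents = 3 ∧
    (orbifoldK s t).numSmoothBoundaryComponents = 1 ∧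
    (orbifoldK s t).numSingularBoundaryComponents = 2 := by
  have hH : ∀ i, ∃ γ ∈ familyH s t i, γ ≠ 1 ∧ ∃ x : E n, ‖x‖ = 1 ∧ γ x = x := by
    intro i
    fin_cases i
    · exact exists_fixed_of_mem_map (Subgroup.mem_zpowers s) hs ha
    · exact exists_fixed_of_mem_map (Subgroup.mem_zpowers t) ht hb
    · exact exists_fixed_of_mem_map (Subgroup.mem_zpowers (s * t)) hst hc
  have hK : ∀ i, (∃ γ ∈ familyK s t i, γ ≠ 1 ∧ ∃ x : E n, ‖x‖ = 1 ∧ γ x = x) ↔ i ≠ 0 := by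
    intro i
    have hsG : s ∈ Subgroup.closure {s, t} := Subgroup.subset_closure (by simp)
    fin_cases i
    · simp [familyK]
    · exact iff_of_true (exists_fixed_of_mem_map hsG hs ha) (by decide)
    · exact iff_of_true (exists_fixed_of_mem_map hsG hs ha) (by decide)
  rw [orbifoldH, orbifoldK]
  simp only [numSmoothBoundaryComponents_ballQuotient _ hn,
    numSingularBoundaryComponents_ballQuotient _ hn, hH, hK, not_not, not_true_eq_false,
    ENat.card_eq_coe_fintype_card]
  decide

end SteklovOrbifold

/-! ### The examples -/

/-- Isospectral examples in all dimensions `n > 2`, where `σ`, `τ` are the reflections in the first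
two coordinate hyperplanes. -/
lemma exists_isospectral_of_three_le (n : ℕ) (hn : 2 < n) :
    ∃ O O' : SteklovOrbifold.CompactRiemannianOrbifold n,
      O.steklovSpectrum = O'.steklovSpectrum ∧
      O.numSmoothBoundaryComponents ≠ O'.numSmoothBoundaryComponents ∧
      O.numSingularBoundaryComponents ≠ O'.numSingularBoundaryComponents := by
  obtain ⟨m, rfl⟩ : ∃ m, n = m + 3 := ⟨n - 3, by omega⟩
  let s : Fin (m + 3) → ℤˣ := Function.update 1 0 (-1)
  let t : Fin (m + 3) → ℤˣ := Function.update 1 1 (-1)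
  have hs : s ≠ 1 := fun h => by simpa [s] using congrFun h 0
  have ht : t ≠ 1 := fun h => by simpa [t] using congrFun h 1
  have hst : s * t ≠ 1 := fun h => by simpa [s, t] using congrFun h 0
  -- The third coordinate is untouched by `s`, `t` and `s * t`. In the plane `s * t` would be `-1`,
  -- which fixes no unit vector; hence `n > 2`.
  have h2 : (2 : Fin (m + 3)) ≠ 0 ∧ (2 : Fin (m + 3)) ≠ 1 := by
    simp [Fin.ext_iff, Nat.mod_eq_of_lt]
  obtain ⟨h1, h3, h4, h5⟩ := SteklovOrbifold.card_boundaryComponents (by omega) hs ht hst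
    (a := 2) (b := 2) (c := 2) (by simp [s, h2.1]) (by simp [t, h2.2]) (by simp [s, t, h2.1, h2.2])
  refine ⟨_, _, SteklovOrbifold.steklovSpectrum_orbifoldH s t, ?_, ?_⟩
  · rw [h1, h4]
    decide
  · rw [h3, h5]
    decide

theorem proposition5p4 :
    -- In every dimension `n > 2`, there are Steklov isospectral compact Riemannian orbifolds with
    -- different numbers of smooth and different numbers of singular boundary components.
    (∀ n : ℕ, 2 < n → ∃ O O' : SteklovOrbifold.CompactRiemannianOrbifold n,
      O.steklovSpectrum = O'.steklovSpectrum ∧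
      O.numSmoothBoundaryComponents ≠ O'.numSmoothBoundaryComponents ∧
      O.numSingularBoundaryComponents ≠ O'.numSingularBoundaryComponents) ∧
    -- For `n = 3` there are the following examples. First, `σ`, `τ` are the rotations through the
    -- angle `π` about the `x`-axis and the `y`-axis; second, `σ`, `τ` are the reflections across
    -- the `xy`-plane and the `xz`-plane.
    (∀ s t : Fin 3 → ℤˣ,
      (s = ![1, -1, -1] ∧ t = ![-1, 1, -1]) ∨ (s = ![1, 1, -1] ∧ t = ![1, -1, 1]) →
      (SteklovOrbifold.orbifoldH s t).steklovSpectrum = (SteklovOrbifold.orbifoldK s t).steklovSpectrum ∧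
      (SteklovOrbifold.orbifoldH s t).numSmoothBoundaryComponents = 0 ∧
      (SteklovOrbifold.orbifoldH s t).numSingularBoundaryComponents = 3 ∧
      (SteklovOrbifold.orbifoldK s t).numSmoothBoundaryComponents = 1 ∧
      (SteklovOrbifold.orbifoldK s t).numSingularBoundaryComponents = 2) := by
  refine ⟨exists_isospectral_of_three_le, ?_⟩
  rintro s t h
  refine ⟨SteklovOrbifold.steklovSpectrum_orbifoldH s t, ?_⟩
  rcases h with ⟨rfl, rfl⟩ | ⟨rfl, rfl⟩
  -- Each of the three rotations fixes its own axis.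
  · exact SteklovOrbifold.card_boundaryComponents (by omega) (by decide) (by decide) (by decide)
      (a := 0) (b := 1) (c := 2) (by decide) (by decide) (by decide)
  -- The `x`-axis is fixed by both reflections, hence by their product.
  · exact SteklovOrbifold.card_boundaryComponents (by omega) (by decide) (by decide) (by decide)
      (a := 0) (b := 0) (c := 0) (by decide) (by decide) (by decide)
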